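/- Let $\mu$ be a finite measure on the unit circle and let $\varphi_j$, $j=0,1,2,\dots$, be polynomials orthonormal with respect to $\mu$: $\varphi_j$ has exact degree $j$ and $\int \varphi_j\overline{\varphi_k}\,d\mu=\delta_{jk}$. For $n \ge 0$ let $\varphi_n^{\ast}$ be the reversed polynomial, $\varphi_n^{\ast}(z)=z^{n}\,\overline{\varphi_n(1/\bar z)}$ (understood as a polynomial, also at $z=0$). Let $N>0$ be an integer, let $a_0,\dots,a_N,b_0,\dots,b_N$ be independent real standard normal random variables, put $\eta_j=a_j+ib_j$ and $S_N(z)=\sum_{j=0}^{N}\eta_j\varphi_j(z)$, and let $\mathbf K=K_1+iK_2\in\mathbb C$. Then the complex zeros of the random equation $S_N(z)=\mathbf K$ have an expected density: there is a unique continuous function $h_{N,\mathbf K}\colon\mathbb C\to[0,\infty)$ such that for every compact $\Phi\subset\mathbb C$ the number $\nu_{N,\mathbf K}(\Phi)$ of points $z\in\Phi$ with $S_N(z)=\mathbf K$ satisfies $\mathbb E\,\nu_{N,\mathbf K}(\Phi)=\int_\Phi h_{N,\mathbf K}(z)\,dx\,dy$. For all $z\in\mathbb C$ with $|z|\neq1$,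 writing $\varphi=\varphi_{N+1}(z)$, $\varphi^{\ast}=\varphi_{N+1}^{\ast}(z)$, $\varphi'=\varphi_{N+1}'(z)$, $\varphi^{\ast\prime}=(\varphi_{N+1}^{\ast})'(z)$, the function $h_{N,\mathbf K}$ is given by \[ \begin{split} h_{N,\mathbf K}(z)={}&\frac1\pi\exp\left\{-\frac{K_1^2+K_2^2}{2}\cdot\frac{1-|z|^2}{|\varphi^{\ast}|^2-|\varphi|^2}\right\}\\ &\times\Bigg\{\frac1{(1-|z|^2)^2}-\frac{|\varphi^{\ast}\varphi'-\varphi^{\ast\prime}\varphi|^2}{(|\varphi^{\ast}|^2-|\varphi|^2)^2} +\frac{K_1^2+K_2^2}{2}\Bigg(\frac{(1-|z|^2)\,\bigl|\overline{\varphi^{\ast\prime}}\varphi^{\ast}-\overline{\varphi'}\varphi\bigr|^2}{(|\varphi^{\ast}|^2-|\varphi|^2)^3}\\ &\qquad+\frac{2\,\mathrm{Re}\bigl(z(\varphi^{\ast\prime}\overline{\varphi^{\ast}}-\varphi'\overline{\varphi})\bigr)}{(|\varphi^{\ast}|^2-|\varphi|^2)^2} +\frac{|z|^2}{(1-|z|^2)(|\varphi^{\ast}|^2-|\varphi|^2)}\Bigg)\Bigg\}.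 \end{split} \] In particular, when $\mathbf K=0$, \[ h_{N,0}(z)=\frac1\pi\left(\frac1{(1-|z|^2)^2}-\frac{|\varphi^{\ast}\varphi'-\varphi^{\ast\prime}\varphi|^2}{(|\varphi^{\ast}|^2-|\varphi|^2)^2}\right). \] -/

import Mathlib

open MeasureTheory ProbabilityTheory Polynomial
open scoped ENNReal

/-- The random sum `S(z) = ∑ j, η j * f j z`, with `η j = a j + i b j`, at the outcome `ω`. -/
noncomputable def randomSum {Ω : Type*} {n : ℕ} (a b : Fin n → Ω → ℝ) (f : Fin n → ℂ → ℂ)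
    (ω : Ω) (z : ℂ) : ℂ :=
  ∑ j, ((a j ω : ℂ) + (b j ω : ℂ) * Complex.I) * f j z

/-- The number (possibly infinite) of points of `Φ` at which `g` takes the value `K`. -/
noncomputable def zeroCount (g : ℂ → ℂ) (K : ℂ) (Φ : Set ℂ) : ℝ≥0∞ :=
  ((Φ ∩ {z | g z = K}).encard : ℝ≥0∞)

/-- `h` is the (continuous) expected density of the complex zeros of the random equation
`S ω z = K`: for every compact `Φ`, the expected number of solutions in `Φ` is `∫_Φ h`
(with respect to planar Lebesgue measure). -/
structure IsExpectedZeroDensity {Ω : Type*} [MeasurableSpace Ω] (P : Measure Ω)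
    (S : Ω → ℂ → ℂ) (K : ℂ) (h : ℂ → ℝ) : Prop where
  continuous : Continuous h
  nonneg : ∀ z, 0 ≤ h z
  aemeasurable_zeroCount : ∀ Φ : Set ℂ, IsCompact Φ →
    AEMeasurable (fun ω => zeroCount (S ω) K Φ) P
  expectation_eq : ∀ Φ : Set ℂ, IsCompact Φ →
    ∫⁻ ω, zeroCount (S ω) K Φ ∂P = ∫⁻ z in Φ, ENNReal.ofReal (h z)

/-- The polynomials `φ 0, φ 1, …` are orthonormal on the unit circle with respect to `μ`, a measure
carried by the unit circle, and `φ n` has exact degree `n`. (Such `μ` necessarily has infinite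
support.) -/
structure IsOrthonormalOnCircle (μ : Measure ℂ) (φ : ℕ → ℂ[X]) : Prop where
  measure_compl_circle : μ (Metric.sphere 0 1)ᶜ = 0
  degree_eq : ∀ n, (φ n).degree = n
  integral_eq : ∀ m n, ∫ ζ, (φ m).eval ζ * (starRingEnd ℂ) ((φ n).eval ζ) ∂μ
    = if m = n then 1 else 0

/-- The reversed polynomial `p* (z) = z ^ n * conj (p (1 / conj z))` of a polynomial `p` of
degree at most `n`: its coefficients are the conjugates of those of `p`, in reverse order. -/
noncomputable def reversedPoly (n : ℕ) (p : ℂ[X]) : ℂ[X] :=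
  (p.map (starRingEnd ℂ)).reflect n

theorem eval_reversedPoly {n : ℕ} {p : ℂ[X]} (hp : p.natDegree ≤ n) {z : ℂ} (hz : z ≠ 0) :
    (reversedPoly n p).eval z
      = z ^ n * (starRingEnd ℂ) (p.eval (1 / (starRingEnd ℂ) z)) := by
  have h1 : (p.map (starRingEnd ℂ)).natDegree ≤ n := natDegree_map_le.trans hp
  let _ : Invertible z⁻¹ := invertibleOfNonzero (inv_ne_zero hz)
  have h := eval₂_reflect_mul_pow (RingHom.id ℂ) z⁻¹ n (p.map (starRingEnd ℂ)) h1
  have h2 : (starRingEnd ℂ) (p.eval (1 / (starRingEnd ℂ) z))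
      = (p.map (starRingEnd ℂ)).eval z⁻¹ := by
    rw [← Polynomial.eval₂_hom, ← Polynomial.eval_map]
    simp
  simp only [invOf_eq_inv, inv_inv, eval₂_id] at h
  rw [h2, ← h, reversedPoly]
  rw [mul_comm, mul_assoc, ← mul_pow, inv_mul_cancel₀ hz, one_pow, mul_one]

open scoped ComplexConjugate

/-! The density is the Kac–Rice quantity E[|S'(z)|² ; S(z) = K], and it is obtained here without
discussing degenerate zeros. Since `φ 0` is a nonzero constant c, once η_1, …, η_N are frozen the
equation S(z) = K reads η_0 = F(z) with F = (K - ∑_{j≥1} η_j φ_j)/c. The number of solutions in Φ is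
thus the multiplicity with which F takes the value η_0 on Φ, and the area formula
(`lintegral_zeroCount_mul`) turns its η_0-expectation into ∫_Φ |F'|² times the Gaussian density at F
(`lintegral_zeroCount_cons`).

After Tonelli, the other η_j are integrated out one at a time. The integrand stays in the family
`gaussianDensityMoment`, each step merely adding |u|², w conj u, |w|² to the parameters, where u =
φ_j(z) and w = φ_j'(z) (`lintegral_pi_gaussianDensityMoment`). The final parameters are A = ∑
|φ_j|², B = ∑ φ_j' conj φ_j, C = ∑ |φ_j'|².

These are the reproducing kernel and its derivatives on the diagonal. The Christoffel–Darboux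
formula and its derivatives express them through φ_{N+1} and its reverse off the unit circle, and
`gaussianDensityMoment_eq_of_kernel` is the remaining algebra. Continuity makes the density unique,
so the formula holds for every such density. -/

/-! ### The area formula for entire functions -/

theorem abs_det_restrictScalars_smulRight (d : ℂ) :
    |(((ContinuousLinearMap.toSpanSingleton ℂ d).restrictScalars ℝ : ℂ →L[ℝ] ℂ)).det|
      = ‖d‖ ^ 2 := by
  have h : LinearMap.det ((ContinuousLinearMap.toSpanSingleton ℂ d : ℂ →L[ℂ] ℂ) : ℂ →ₗ[ℂ] ℂ)
      = d := by
    rw [LinearMap.det_ring]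
    simp
  have h2 : ((ContinuousLinearMap.toSpanSingleton ℂ d).restrictScalars ℝ : ℂ →L[ℝ] ℂ).det
      = ‖d‖ ^ 2 := by
    have := LinearMap.det_restrictScalars (R := ℝ) (S := ℂ)
      (f := ((ContinuousLinearMap.toSpanSingleton ℂ d : ℂ →L[ℂ] ℂ) : ℂ →ₗ[ℂ] ℂ))
    rw [h, Algebra.norm_complex_apply, Complex.normSq_eq_norm_sq] at this
    exact this
  rw [h2, abs_of_nonneg (by positivity)]

theorem hasFDerivWithinAt_restrictScalars {f : ℂ → ℂ} (hf : Differentiable ℂ f) (s : Set ℂ)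
    (z : ℂ) : HasFDerivWithinAt f
      ((ContinuousLinearMap.toSpanSingleton ℂ (deriv f z)).restrictScalars ℝ) s z :=
  ((hf z).hasDerivAt.hasFDerivAt.restrictScalars ℝ).hasFDerivWithinAt

theorem volume_image_deriv_eq_zero {f : ℂ → ℂ} (hf : Differentiable ℂ f) :
    volume (f '' {z | deriv f z = 0}) = 0 := by
  refine addHaar_image_eq_zero_of_det_fderivWithin_eq_zero volume
    (fun z _ => hasFDerivWithinAt_restrictScalars hf _ z) fun z hz => ?_
  have := abs_det_restrictScalars_smulRight (deriv f z)
  rw [show deriv f z = 0 from hz] at this ⊢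
  simpa using this

/-- Off its critical points an entire function is injective on countably many open sets
covering the complement. -/
theorem exists_open_cover_injOn {f : ℂ → ℂ} (hf : Differentiable ℂ f) :
    ∃ u : ℕ → Set ℂ, (∀ n, MeasurableSet (u n)) ∧ (∀ n, Set.InjOn f (u n)) ∧
      {z | deriv f z ≠ 0} ⊆ ⋃ n, u n := by
  obtain ⟨b, hbc, -, hb⟩ := TopologicalSpace.exists_countable_basis ℂ
  -- The empty set keeps the family nonempty, so that it is the range of a sequence.
  let c : Set (Set ℂ) := insert ∅ {v ∈ b | Set.InjOn f v}
  have hc : c.Countable := (hbc.mono (Set.sep_subset _ _)).insert _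
  obtain ⟨u, hu⟩ := hc.exists_eq_range ⟨∅, Set.mem_insert _ _⟩
  have huc : ∀ n, u n ∈ c := fun n => hu ▸ Set.mem_range_self n
  refine ⟨u, fun n => ?_, fun n => ?_, fun z hz => ?_⟩
  · rcases huc n with h | h
    · rw [h]; exact MeasurableSet.empty
    · exact (hb.isOpen h.1).measurableSet
  · rcases huc n with h | h
    · rw [h]; exact Set.injOn_empty _
    · exact h.2
  · have hs : HasStrictDerivAt f (deriv f z) z :=
      (hf.analyticAt z).hasStrictDerivAt
    have hs' := hs.hasStrictFDerivAt_equiv hz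
    obtain ⟨v, hvz, hvo, hv⟩ := hs'.approximates_deriv_on_open_nhds
    have hinj : Set.InjOn f v := hv.injOn (Or.inr (by
      refine NNReal.half_lt_self ?_
      exact inv_ne_zero (ContinuousLinearEquiv.nnnorm_symm_pos _).ne'))
    obtain ⟨w, hwb, hzw, hwv⟩ := hb.exists_subset_of_mem_open hvz hvo
    have : w ∈ c := Or.inr ⟨hwb, hinj.mono hwv⟩
    rw [hu] at this
    obtain ⟨n, rfl⟩ := this
    exact Set.mem_iUnion.2 ⟨n, hzw⟩

theorem count_inter_fiber_of_injOn {f : ℂ → ℂ} {t : Set ℂ} (h : Set.InjOn f t) (y : ℂ) :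
    Measure.count (t ∩ {z | f z = y}) = (f '' t).indicator 1 y := by
  by_cases hy : y ∈ f '' t
  · obtain ⟨z, hz, rfl⟩ := hy
    have : t ∩ {x | f x = f z} = {z} := by
      ext x
      constructor
      · rintro ⟨hx, hxz⟩
        exact h hx hz hxz
      · rintro rfl
        exact ⟨hz, rfl⟩
    rw [this, Measure.count_singleton, Set.indicator_of_mem (Set.mem_image_of_mem f hz)]
    rfl
  · have : t ∩ {x | f x = y} = ∅ := by
      ext x
      simp only [Set.mem_inter_iff, Set.mem_ofPred_eq, Set.mem_empty_iff_false, iff_false]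
      rintro ⟨hx, rfl⟩
      exact hy ⟨x, hx, rfl⟩
    rw [this, measure_empty, Set.indicator_of_notMem hy]

/-- The area formula with multiplicity for an entire function. -/
theorem lintegral_zeroCount_mul {f : ℂ → ℂ} (hf : Differentiable ℂ f) {s : Set ℂ}
    (hs : MeasurableSet s) {g : ℂ → ℝ≥0∞} (hg : Measurable g) :
    ∫⁻ y, zeroCount f y s * g y = ∫⁻ z in s, ENNReal.ofReal (‖deriv f z‖ ^ 2) * g (f z) := by
  obtain ⟨u, hum, hui, hu⟩ := exists_open_cover_injOn hf
  have hdc : Measurable (deriv f) := measurable_deriv f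
  have hZ : MeasurableSet {z | deriv f z = 0} := hdc (measurableSet_singleton 0)
  let t : ℕ → Set ℂ := fun n => (s \ {z | deriv f z = 0}) ∩ disjointed u n
  have htm : ∀ n, MeasurableSet (t n) := fun n => (hs.diff hZ).inter (.disjointed hum n)
  have hti : ∀ n, Set.InjOn f (t n) := fun n =>
    (hui n).mono (Set.inter_subset_right.trans (disjointed_subset u n))
  have htd : Pairwise (Function.onFun Disjoint t) := fun i j hij =>
    ((disjoint_disjointed u) hij).mono Set.inter_subset_right Set.inter_subset_right
  have htU : ⋃ n, t n = s \ {z | deriv f z = 0} := by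
    rw [← Set.inter_iUnion, iUnion_disjointed]
    exact Set.inter_eq_left.2 fun z hz => hu hz.2
  have hfib : ∀ y, MeasurableSet {z | f z = y} := fun y =>
    (hf.continuous.measurable) (measurableSet_singleton y)
  -- Critical values form a null set. Discarding them also covers constant f, whose one nonempty
  -- fibre may be infinite.
  have hae : ∀ᵐ y, zeroCount f y s * g y = ∑' n, (f '' t n).indicator g y := by
    have h0 := volume_image_deriv_eq_zero hf
    filter_upwards [measure_eq_zero_iff_ae_notMem.1 h0] with y hy
    have h1 : zeroCount f y s = ∑' n, (f '' t n).indicator 1 y := by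
      have h2 : s ∩ {z | f z = y} = ⋃ n, (t n ∩ {z | f z = y}) := by
        rw [← Set.iUnion_inter, htU]
        ext z
        simp only [Set.mem_inter_iff, Set.mem_sdiff, Set.mem_ofPred_eq]
        refine ⟨fun h => ⟨⟨h.1, fun hz => hy ⟨z, hz, h.2⟩⟩, h.2⟩, fun h => ⟨h.1.1, h.2⟩⟩
      rw [zeroCount, ← Measure.count_apply (hs.inter (hfib y)), h2, measure_iUnion]
      · exact tsum_congr fun n => count_inter_fiber_of_injOn (hti n) y
      · exact fun i j hij => (htd hij).mono Set.inter_subset_left Set.inter_subset_left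
      · exact fun n => (htm n).inter (hfib y)
    rw [h1, ← ENNReal.tsum_mul_right]
    refine tsum_congr fun n => ?_
    by_cases h : y ∈ f '' t n <;> simp [h]
  have him : ∀ n, MeasurableSet (f '' t n) := fun n =>
    measurable_image_of_fderivWithin (htm n)
      (fun z _ => hasFDerivWithinAt_restrictScalars hf _ z) (hti n)
  rw [lintegral_congr_ae hae, lintegral_tsum fun n => (hg.indicator (him n)).aemeasurable]
  have h3 : ∀ n, ∫⁻ y, (f '' t n).indicator g y
      = ∫⁻ z in t n, ENNReal.ofReal (‖deriv f z‖ ^ 2) * g (f z) := fun n => by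
    rw [lintegral_indicator (him n), lintegral_image_eq_lintegral_abs_det_fderiv_mul volume (htm n)
      (fun z _ => hasFDerivWithinAt_restrictScalars hf _ z) (hti n)]
    simp_rw [abs_det_restrictScalars_smulRight]
  simp_rw [h3]
  rw [← lintegral_iUnion htm htd, htU, ← lintegral_indicator (hs.diff hZ),
    ← lintegral_indicator hs]
  congr 1
  ext z
  by_cases h1 : z ∈ s <;> by_cases h2 : deriv f z = 0 <;> simp [h1, h2]

/-! ### Measurability of the zero count -/

/-- Projection along a compact factor is a closed map. -/
theorem isClosed_setOf_exists_mem_compact {X : Type*} [TopologicalSpace X] {F : X → ℂ → ℂ}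
    (hF : Continuous (Function.uncurry F)) (K : ℂ) {C : Set ℂ} (hC : IsCompact C) :
    IsClosed {x | ∃ z ∈ C, F x z = K} := by
  have := isCompact_iff_compactSpace.1 hC
  have h1 : IsClosed {p : X × C | F p.1 p.2 = K} := by
    refine isClosed_eq ?_ continuous_const
    exact hF.comp (continuous_fst.prodMk (continuous_subtype_val.comp continuous_snd))
  convert isClosedMap_fst_of_compactSpace _ h1 using 1
  ext x
  simp

theorem exists_closedBall_denseSeq_subset {U : Set ℂ} (hU : IsOpen U) {z : ℂ} (hz : z ∈ U) :
    ∃ i : ℕ × ℕ, z ∈ Metric.closedBall (TopologicalSpace.denseSeq ℂ i.1) (1 / ((i.2 : ℝ) + 1)) ∧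
      Metric.closedBall (TopologicalSpace.denseSeq ℂ i.1) (1 / ((i.2 : ℝ) + 1)) ⊆ U := by
  obtain ⟨ε, hε, hεU⟩ := Metric.isOpen_iff.1 hU z hz
  obtain ⟨n, hn⟩ := exists_nat_one_div_lt (half_pos hε)
  obtain ⟨m, hm⟩ := (TopologicalSpace.denseRange_denseSeq ℂ).exists_dist_lt z
    (Nat.one_div_pos_of_nat (α := ℝ) (n := n))
  refine ⟨(m, n), Metric.mem_closedBall.2 hm.le, fun w hw => hεU ?_⟩
  rw [Metric.mem_closedBall] at hw
  rw [Metric.mem_ball]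
  have := dist_triangle_right w z (TopologicalSpace.denseSeq ℂ m)
  dsimp only at hw
  linarith

theorem sum_indicator_nonempty_le_encard {ι : Type*} {A : Set ℂ} (hA : MeasurableSet A)
    {B : ι → Set ℂ} (hB : ∀ i, MeasurableSet (B i)) {T : Finset ι}
    (hT : (T : Set ι).PairwiseDisjoint B) :
    ∑ i ∈ T, {D : Set ℂ | (A ∩ D).Nonempty}.indicator 1 (B i) ≤ ((A.encard : ℕ∞) : ℝ≥0∞) := by
  rw [← Measure.count_apply hA]
  calc ∑ i ∈ T, {D : Set ℂ | (A ∩ D).Nonempty}.indicator 1 (B i)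
      ≤ ∑ i ∈ T, Measure.count (A ∩ B i) := by
        refine Finset.sum_le_sum fun i _ => ?_
        by_cases h : (A ∩ B i).Nonempty
        · rw [Set.indicator_of_mem (by exact h)]
          obtain ⟨z, hz⟩ := h
          rw [Pi.one_apply, ← Measure.count_singleton z]
          exact measure_mono (Set.singleton_subset_iff.2 hz)
        · rw [Set.indicator_of_notMem (by exact h)]
          exact zero_le
    _ = Measure.count (⋃ i ∈ T, A ∩ B i) := by
        refine (measure_biUnion_finset ?_ fun i _ => hA.inter (hB i)).symm
        exact fun i hi j hj hij => (hT hi hj hij).mono Set.inter_subset_right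
          Set.inter_subset_right
    _ ≤ Measure.count A := measure_mono (Set.iUnion₂_subset fun i _ => Set.inter_subset_left)

theorem exists_disjoint_closedBall_card_le {A : Set ℂ} {S : Finset ℂ} (hS : (S : Set ℂ) ⊆ A) :
    ∃ T : Finset (ℕ × ℕ), ((T : Set (ℕ × ℕ)).PairwiseDisjoint fun i =>
        Metric.closedBall (TopologicalSpace.denseSeq ℂ i.1) (1 / ((i.2 : ℝ) + 1))) ∧
      (S.card : ℝ≥0∞) ≤ ∑ i ∈ T, {B : Set ℂ | (A ∩ B).Nonempty}.indicator 1
        (Metric.closedBall (TopologicalSpace.denseSeq ℂ i.1) (1 / ((i.2 : ℝ) + 1))) := by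
  classical
  obtain ⟨U, hU, hUd⟩ := S.finite_toSet.t2_separation
  choose i hi hiU using fun z => exists_closedBall_denseSeq_subset (hU z).2 (hU z).1
  have hinj : Set.InjOn i S := by
    intro z hz w hw hzw
    by_contra hne
    refine Set.disjoint_left.1 (hUd hz hw hne) (hU z).1 (hiU w ?_)
    rw [← hzw]
    exact hi z
  refine ⟨S.image i, ?_, ?_⟩
  · rw [Finset.coe_image]
    rintro _ ⟨z, hz, rfl⟩ _ ⟨w, hw, rfl⟩ hne
    exact (hUd hz hw (fun h => hne (by rw [h]))).mono (hiU z) (hiU w)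
  · rw [Finset.sum_image hinj, Finset.cast_card]
    refine Finset.sum_le_sum fun z hz => ?_
    rw [Set.indicator_of_mem (by exact ⟨z, hS hz, hi z⟩)]
    rfl

/-- Disjoint balls that meet A give distinct points of A, and finitely many points of A can be
separated by disjoint balls from a countable family. The cardinality thus becomes a countable
supremum of sums of hitting indicators, whose measurability in a parameter can be checked ball by
ball. -/
theorem encard_eq_iSup_disjoint_closedBall {A : Set ℂ} (hA : MeasurableSet A) :
    ((A.encard : ℕ∞) : ℝ≥0∞) = ⨆ T : {T : Finset (ℕ × ℕ) //
      (T : Set (ℕ × ℕ)).PairwiseDisjoint fun i =>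
        Metric.closedBall (TopologicalSpace.denseSeq ℂ i.1) (1 / ((i.2 : ℝ) + 1))},
      ∑ i ∈ T.1, {B : Set ℂ | (A ∩ B).Nonempty}.indicator 1
        (Metric.closedBall (TopologicalSpace.denseSeq ℂ i.1) (1 / ((i.2 : ℝ) + 1))) := by
  refine le_antisymm ?_ (iSup_le fun T => sum_indicator_nonempty_le_encard hA
    (fun _ => Metric.isClosed_closedBall.measurableSet) T.2)
  have key : ∀ S : Finset ℂ, (S : Set ℂ) ⊆ A → (S.card : ℝ≥0∞) ≤ _ := fun S hS => by
    obtain ⟨T, hT, h⟩ := exists_disjoint_closedBall_card_le hS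
    exact h.trans (le_iSup (fun T : {T : Finset (ℕ × ℕ) //
      (T : Set (ℕ × ℕ)).PairwiseDisjoint fun i =>
        Metric.closedBall (TopologicalSpace.denseSeq ℂ i.1) (1 / ((i.2 : ℝ) + 1))} =>
      ∑ i ∈ T.1, {B : Set ℂ | (A ∩ B).Nonempty}.indicator (1 : Set ℂ → ℝ≥0∞)
        (Metric.closedBall (TopologicalSpace.denseSeq ℂ i.1) (1 / ((i.2 : ℝ) + 1)))) ⟨T, hT⟩)
  rcases A.finite_or_infinite with h | h
  · rw [h.encard_eq_coe_toFinset_card]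
    exact key h.toFinset (by simp)
  · refine le_top.trans (le_of_tendsto' ENNReal.tendsto_nat_nhds_top fun n => ?_)
    obtain ⟨S, hS, rfl⟩ := h.exists_subset_card_eq n
    exact key S hS

theorem measurable_zeroCount {X : Type*} [TopologicalSpace X] [MeasurableSpace X] [BorelSpace X]
    {F : X → ℂ → ℂ} (hF : Continuous (Function.uncurry F)) (K : ℂ) {C : Set ℂ}
    (hC : IsCompact C) : Measurable fun x => zeroCount (F x) K C := by
  have hm : ∀ x, MeasurableSet (C ∩ {z | F x z = K}) := fun x =>
    hC.measurableSet.inter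
      (isClosed_eq (hF.comp (Continuous.prodMk_right x)) continuous_const).measurableSet
  simp_rw [zeroCount, encard_eq_iSup_disjoint_closedBall (hm _)]
  refine Measurable.iSup fun T => Finset.measurable_sum _ fun i _ => ?_
  -- Closed balls are used so that their intersection with C is compact.
  have h := isClosed_setOf_exists_mem_compact hF K
    (hC.inter_right (Metric.isClosed_closedBall (x := TopologicalSpace.denseSeq ℂ i.1)
      (ε := 1 / ((i.2 : ℝ) + 1))))
  have h2 : Measurable (_ : X → ℝ≥0∞) :=
    (measurable_const (a := (1 : ℝ≥0∞))).indicator h.measurableSet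
  convert h2 using 2 with x
  simp only [Set.indicator, Set.mem_ofPred_eq, Pi.one_apply]
  congr 1
  simp only [eq_iff_iff]
  constructor
  · rintro ⟨z, hz, hz'⟩
    exact ⟨z, ⟨hz.1, hz'⟩, hz.2⟩
  · rintro ⟨z, hz, hz'⟩
    exact ⟨z, ⟨hz.1, hz'⟩, hz.2⟩

/-! ### Complex Gaussian variables -/

/-- The law of `X + i Y` with `X`, `Y` independent normal variables of variance `v` and means
`m.re`, `m.im`. -/
noncomputable def complexGaussian (m : ℂ) (v : NNReal) : Measure ℂ :=
  ((gaussianReal m.re v).prod (gaussianReal m.im v)).map Complex.measurableEquivRealProd.symm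

instance (m : ℂ) (v : NNReal) : IsProbabilityMeasure (complexGaussian m v) :=
  Measure.isProbabilityMeasure_map Complex.measurableEquivRealProd.symm.measurable.aemeasurable

/-- The density of `complexGaussian m v`. -/
noncomputable def complexGaussianPDF (m : ℂ) (v : ℝ) (z : ℂ) : ℝ :=
  Real.exp (-(‖z - m‖ ^ 2 / (2 * v))) / (2 * Real.pi * v)

theorem complexGaussianPDF_nonneg (m : ℂ) {v : ℝ} (hv : 0 ≤ v) (z : ℂ) :
    0 ≤ complexGaussianPDF m v z := by
  unfold complexGaussianPDF; positivity

theorem continuous_complexGaussianPDF (m : ℂ) (v : ℝ) : Continuous (complexGaussianPDF m v) := by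
  unfold complexGaussianPDF; fun_prop

theorem lintegral_complexGaussian {m : ℂ} {v : NNReal} (hv : v ≠ 0) {g : ℂ → ℝ≥0∞}
    (hg : Measurable g) :
    ∫⁻ z, g z ∂complexGaussian m v
      = ∫⁻ z, ENNReal.ofReal (complexGaussianPDF m v z) * g z := by
  have e := Complex.volume_preserving_equiv_real_prod.symm
  have hpm : Measurable fun z => ENNReal.ofReal (complexGaussianPDF m v z) :=
    (continuous_complexGaussianPDF m v).measurable.ennreal_ofReal
  rw [complexGaussian, lintegral_map hg Complex.measurableEquivRealProd.symm.measurable,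
    gaussianReal_of_var_ne_zero _ hv, gaussianReal_of_var_ne_zero _ hv,
    prod_withDensity (measurable_gaussianPDF _ _) (measurable_gaussianPDF _ _),
    lintegral_withDensity_eq_lintegral_mul _ (by fun_prop)
      (show Measurable fun a => g (Complex.measurableEquivRealProd.symm a) from
        hg.comp Complex.measurableEquivRealProd.symm.measurable),
    ← e.lintegral_comp (show Measurable fun z => ENNReal.ofReal (complexGaussianPDF m v z) * g z
      from hpm.mul hg), Measure.volume_eq_prod]
  refine lintegral_congr fun p => ?_
  simp only [Pi.mul_apply]
  congr 1
  rw [gaussianPDF, gaussianPDF, ← ENNReal.ofReal_mul (gaussianPDFReal_nonneg _ _ _)]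
  congr 1
  have hv' : (0 : ℝ) < v := by positivity
  rw [gaussianPDFReal, gaussianPDFReal, complexGaussianPDF, ← Complex.normSq_eq_norm_sq,
    Complex.normSq_apply]
  simp only [Complex.sub_re, Complex.sub_im, Complex.measurableEquivRealProd_symm_apply]
  rw [mul_mul_mul_comm, ← Real.exp_add, ← mul_inv, Real.mul_self_sqrt (by positivity)]
  rw [mul_comm, div_eq_mul_inv]
  congr 2
  field_simp
  ring

theorem integral_sq_gaussianReal (m : ℝ) (v : NNReal) :
    ∫ x, x ^ 2 ∂gaussianReal m v = v + m ^ 2 := by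
  have h := variance_eq_sub (memLp_id_gaussianReal (μ := m) (v := v) 2)
  rw [variance_id_gaussianReal] at h
  simp only [id, Pi.pow_apply, integral_id_gaussianReal] at h
  linarith

theorem integrable_id_gaussianReal' (m : ℝ) (v : NNReal) :
    Integrable (fun x => x) (gaussianReal m v) :=
  (memLp_id_gaussianReal (μ := m) (v := v) 1).integrable le_rfl

theorem integrable_sq_gaussianReal (m : ℝ) (v : NNReal) :
    Integrable (fun x => x ^ 2) (gaussianReal m v) :=
  (memLp_id_gaussianReal (μ := m) (v := v) 2).integrable_sq

theorem lintegral_normSq_affine_complexGaussian (m : ℂ) (v : NNReal) (α β : ℂ) {τ : ℝ}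
    (hτ : 0 ≤ τ) :
    ∫⁻ z, ENNReal.ofReal (‖α + β * z‖ ^ 2 + τ) ∂complexGaussian m v
      = ENNReal.ofReal (‖α + β * m‖ ^ 2 + 2 * ‖β‖ ^ 2 * v + τ) := by
  have hm : Measurable fun z => ENNReal.ofReal (‖α + β * z‖ ^ 2 + τ) := by fun_prop
  rw [complexGaussian, lintegral_map hm Complex.measurableEquivRealProd.symm.measurable]
  set c₀ := ‖α‖ ^ 2 + τ with hc₀
  set c₁ := 2 * (α.re * β.re + α.im * β.im) with hc₁
  set c₂ := 2 * (α.im * β.re - α.re * β.im) with hc₂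
  have hexp : ∀ x y : ℝ, ‖α + β * (⟨x, y⟩ : ℂ)‖ ^ 2 + τ
      = c₀ + (c₁ * x + ‖β‖ ^ 2 * x ^ 2) + (c₂ * y + ‖β‖ ^ 2 * y ^ 2) := by
    intro x y
    simp only [hc₀, hc₁, hc₂, ← Complex.normSq_eq_norm_sq, Complex.normSq_apply, Complex.add_re,
      Complex.add_im, Complex.mul_re, Complex.mul_im]
    ring
  set P := gaussianReal m.re v
  set Q := gaussianReal m.im v
  have i1 : Integrable (fun x => c₁ * x + ‖β‖ ^ 2 * x ^ 2) P :=
    ((integrable_id_gaussianReal' _ _).const_mul _).add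
      ((integrable_sq_gaussianReal _ _).const_mul _)
  have i2 : Integrable (fun x => c₂ * x + ‖β‖ ^ 2 * x ^ 2) Q :=
    ((integrable_id_gaussianReal' _ _).const_mul _).add
      ((integrable_sq_gaussianReal _ _).const_mul _)
  have j1 : Integrable (fun p : ℝ × ℝ => c₀ + (c₁ * p.1 + ‖β‖ ^ 2 * p.1 ^ 2)) (P.prod Q) :=
    (integrable_const _).add (i1.comp_fst Q)
  have j2 : Integrable (fun p : ℝ × ℝ => c₂ * p.2 + ‖β‖ ^ 2 * p.2 ^ 2) (P.prod Q) :=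
    i2.comp_snd P
  have k1 : ∫ x, (c₁ * x + ‖β‖ ^ 2 * x ^ 2) ∂P
      = c₁ * m.re + ‖β‖ ^ 2 * (v + m.re ^ 2) := by
    rw [integral_add ((integrable_id_gaussianReal' _ _).const_mul _)
      ((integrable_sq_gaussianReal _ _).const_mul _), integral_const_mul, integral_const_mul,
      integral_sq_gaussianReal, integral_id_gaussianReal]
  have k2 : ∫ x, (c₂ * x + ‖β‖ ^ 2 * x ^ 2) ∂Q
      = c₂ * m.im + ‖β‖ ^ 2 * (v + m.im ^ 2) := by
    rw [integral_add ((integrable_id_gaussianReal' _ _).const_mul _)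
      ((integrable_sq_gaussianReal _ _).const_mul _), integral_const_mul, integral_const_mul,
      integral_sq_gaussianReal, integral_id_gaussianReal]
  simp only [Complex.measurableEquivRealProd_symm_apply, hexp]
  have hnn : ∀ p : ℝ × ℝ, 0 ≤ c₀ + (c₁ * p.1 + ‖β‖ ^ 2 * p.1 ^ 2)
      + (c₂ * p.2 + ‖β‖ ^ 2 * p.2 ^ 2) := fun p => by
    rw [← hexp p.1 p.2]
    positivity
  have hint : Integrable (fun p : ℝ × ℝ => c₀ + (c₁ * p.1 + ‖β‖ ^ 2 * p.1 ^ 2)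
      + (c₂ * p.2 + ‖β‖ ^ 2 * p.2 ^ 2)) (P.prod Q) := j1.add j2
  rw [← ofReal_integral_eq_lintegral_ofReal hint (Filter.Eventually.of_forall hnn)]
  congr 1
  rw [integral_add j1 j2, integral_add (integrable_const _) (i1.comp_fst Q)]
  rw [integral_fun_fst (fun x => c₁ * x + ‖β‖ ^ 2 * x ^ 2),
    integral_fun_snd (fun x => c₂ * x + ‖β‖ ^ 2 * x ^ 2), k1, k2]
  have := hexp m.re m.im
  rw [show (⟨m.re, m.im⟩ : ℂ) = m from rfl] at this
  simp
  linarith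

/-! ### Integrating out one Gaussian coefficient at a time -/

/-- The value at `k` of `z ↦ E[|v + V|² ; U = z]`, for centred complex Gaussian `U`, `V` with
`E|U|² = 2 A`, `E[V conj U] = 2 B`, `E|V|² = 2 C`. -/
noncomputable def gaussianDensityMoment (A : ℝ) (B : ℂ) (C : ℝ) (k v : ℂ) : ℝ :=
  complexGaussianPDF 0 A k * (‖v + k * B / A‖ ^ 2 + 2 * (C - ‖B‖ ^ 2 / A))

theorem continuous_gaussianDensityMoment (A : ℝ) (B : ℂ) (C : ℝ) :
    Continuous fun p : ℂ × ℂ => gaussianDensityMoment A B C p.1 p.2 := by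
  unfold gaussianDensityMoment
  have := continuous_complexGaussianPDF 0 A
  fun_prop

/-- Completing the square: the joint density of η and U + ηu, with U independent of η, is the
marginal density of the sum times the conditional density of η given the sum. -/
theorem complexGaussianPDF_mul {A : ℝ} (hA : 0 < A) (u k η : ℂ) :
    complexGaussianPDF 0 1 η * complexGaussianPDF 0 A (k - η * u)
      = complexGaussianPDF 0 (A + ‖u‖ ^ 2) k
        * complexGaussianPDF (k * (starRingEnd ℂ) u / (A + ‖u‖ ^ 2 : ℝ)) (A / (A + ‖u‖ ^ 2)) η := by
  have hA' : 0 < A + ‖u‖ ^ 2 := by positivity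
  have hpi := Real.pi_pos
  unfold complexGaussianPDF
  rw [div_mul_div_comm, div_mul_div_comm, ← Real.exp_add, ← Real.exp_add]
  congr 1
  · congr 1
    set A' := A + ‖u‖ ^ 2 with hA'def
    have hu : ‖u‖ ^ 2 = A' - A := by rw [hA'def]; ring
    apply Complex.ofReal_injective
    have hAc : (A : ℂ) ≠ 0 := by exact_mod_cast hA.ne'
    have hAc' : (A' : ℂ) ≠ 0 := by exact_mod_cast hA'.ne'
    have huc : u * (starRingEnd ℂ) u = A' - A := by
      rw [Complex.mul_conj']; exact_mod_cast hu
    push_cast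
    simp only [← Complex.mul_conj', map_sub, map_mul, map_div₀, Complex.conj_ofReal,
      Complex.conj_conj, sub_zero]
    field_simp
    linear_combination (-(A' : ℂ) * η * (starRingEnd ℂ) η + k * (starRingEnd ℂ) k) * huc
  · field_simp

/-- Both sides are the conditional variance of V + ηw given U + ηu, up to a factor 2. On the left it
is split into the part due to η and the old conditional variance, which shows that it stays
nonnegative. -/
theorem norm_sq_sub_add_eq {A : ℝ} (hA : 0 < A) (B : ℂ) (C : ℝ) (u w : ℂ) :
    ‖w - u * B / A‖ ^ 2 * (A / (A + ‖u‖ ^ 2)) + (C - ‖B‖ ^ 2 / A)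
      = C + ‖w‖ ^ 2 - ‖B + w * (starRingEnd ℂ) u‖ ^ 2 / (A + ‖u‖ ^ 2) := by
  have hA' : 0 < A + ‖u‖ ^ 2 := by positivity
  have hAc : (A : ℂ) ≠ 0 := by exact_mod_cast hA.ne'
  have hAc' : (A : ℂ) + u * (starRingEnd ℂ) u ≠ 0 := by
    rw [Complex.mul_conj']; exact_mod_cast hA'.ne'
  apply Complex.ofReal_injective
  push_cast
  simp only [← Complex.mul_conj', map_sub, map_add, map_mul, map_div₀, Complex.conj_ofReal,
      Complex.conj_conj]
  field_simp
  ring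

/-- Conditioning on η: the pair (U + ηu, V + ηw) is again centred Gaussian, with the covariances of
the two independent pairs added. -/
theorem lintegral_gaussianDensityMoment {A : ℝ} (hA : 0 < A) {B : ℂ} {C : ℝ}
    (hC : 0 ≤ C - ‖B‖ ^ 2 / A) (k v u w : ℂ) :
    ∫⁻ η, ENNReal.ofReal (gaussianDensityMoment A B C (k - η * u) (v + η * w))
        ∂complexGaussian 0 1
      = ENNReal.ofReal (gaussianDensityMoment (A + ‖u‖ ^ 2) (B + w * (starRingEnd ℂ) u)
          (C + ‖w‖ ^ 2) k v) := by
  have hA' : 0 < A + ‖u‖ ^ 2 := by positivity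
  have hAc : (A : ℂ) ≠ 0 := by exact_mod_cast hA.ne'
  have hAc' : ((A + ‖u‖ ^ 2 : ℝ) : ℂ) ≠ 0 := by exact_mod_cast hA'.ne'
  set m := k * (starRingEnd ℂ) u / (A + ‖u‖ ^ 2 : ℝ) with hm
  set s : NNReal := ⟨A / (A + ‖u‖ ^ 2), by positivity⟩ with hs
  have hs0 : s ≠ 0 := by
    rw [← NNReal.coe_ne_zero]; exact (div_pos hA hA').ne'
  have hmeas : Measurable fun η => ENNReal.ofReal
      (gaussianDensityMoment A B C (k - η * u) (v + η * w)) := by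
    refine Continuous.measurable ?_ |>.ennreal_ofReal
    exact (continuous_gaussianDensityMoment A B C).comp
      (f := fun η : ℂ => (k - η * u, v + η * w)) (by fun_prop)
  rw [lintegral_complexGaussian one_ne_zero hmeas]
  set α := v + k * B / A with hα
  set β := w - u * B / A with hβ
  set τ := 2 * (C - ‖B‖ ^ 2 / A) with hτ
  -- The marginal density leaves the integral; what remains is the second moment of an affine
  -- function of η under its conditional law.
  have h1 : ∀ η, ENNReal.ofReal (complexGaussianPDF 0 (1 : NNReal) η)
      * ENNReal.ofReal (gaussianDensityMoment A B C (k - η * u) (v + η * w))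
      = ENNReal.ofReal (complexGaussianPDF 0 (A + ‖u‖ ^ 2) k) *
        (ENNReal.ofReal (complexGaussianPDF m s η) * ENNReal.ofReal (‖α + β * η‖ ^ 2 + τ)) := by
    intro η
    rw [← ENNReal.ofReal_mul (complexGaussianPDF_nonneg _ (NNReal.coe_nonneg _) _),
      ← ENNReal.ofReal_mul (complexGaussianPDF_nonneg _ (NNReal.coe_nonneg _) _),
      ← ENNReal.ofReal_mul (complexGaussianPDF_nonneg _ hA'.le _)]
    congr 1
    rw [gaussianDensityMoment, ← mul_assoc, ← mul_assoc]
    congr 1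
    · exact complexGaussianPDF_mul hA u k η
    · congr 3
      rw [hα, hβ]
      field_simp
      ring
  simp_rw [h1]
  rw [lintegral_const_mul' _ _ ENNReal.ofReal_ne_top,
    ← lintegral_complexGaussian hs0 (by fun_prop),
    lintegral_normSq_affine_complexGaussian _ _ _ _ (by positivity),
    ← ENNReal.ofReal_mul (complexGaussianPDF_nonneg _ hA'.le _)]
  congr 1
  rw [gaussianDensityMoment]
  congr 1
  have e1 : α + β * m = v + k * (B + w * (starRingEnd ℂ) u) / (A + ‖u‖ ^ 2 : ℝ) := by
    have huc : u * (starRingEnd ℂ) u = (A + ‖u‖ ^ 2 : ℝ) - A := by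
      rw [Complex.mul_conj']; push_cast; ring
    rw [hα, hβ, hm]
    field_simp
    linear_combination (-k * B) * huc
  have e2 := norm_sq_sub_add_eq hA B C u w
  rw [e1, add_assoc, ← e2, hτ]
  congr 1
  have hsv : (s : ℝ) = A / (A + ‖u‖ ^ 2) := rfl
  rw [hsv, hβ]
  ring

theorem lintegral_pi_gaussianDensityMoment (n : ℕ) : ∀ {A : ℝ} (_ : 0 < A) {B : ℂ} {C : ℝ}
    (_ : 0 ≤ C - ‖B‖ ^ 2 / A) (k v : ℂ) (u w : Fin n → ℂ),
    ∫⁻ η : Fin n → ℂ, ENNReal.ofReal (gaussianDensityMoment A B C (k - ∑ j, η j * u j)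
        (v + ∑ j, η j * w j)) ∂Measure.pi (fun _ => complexGaussian 0 1)
      = ENNReal.ofReal (gaussianDensityMoment (A + ∑ j, ‖u j‖ ^ 2)
          (B + ∑ j, w j * (starRingEnd ℂ) (u j)) (C + ∑ j, ‖w j‖ ^ 2) k v) := by
  induction n with
  | zero =>
    intro A hA B C hC k v u w
    simp
  | succ n ih =>
    intro A hA B C hC k v u w
    have hA' : 0 < A + ‖u 0‖ ^ 2 := by positivity
    have hC' : 0 ≤ C + ‖w 0‖ ^ 2
        - ‖B + w 0 * (starRingEnd ℂ) (u 0)‖ ^ 2 / (A + ‖u 0‖ ^ 2) := by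
      rw [← norm_sq_sub_add_eq hA]; positivity
    have mp := (measurePreserving_piFinSuccAbove
      (fun _ : Fin (n + 1) => complexGaussian 0 1) 0).symm
    have hcont : Continuous fun η : Fin (n + 1) → ℂ => gaussianDensityMoment A B C
        (k - ∑ j, η j * u j) (v + ∑ j, η j * w j) :=
      (continuous_gaussianDensityMoment A B C).comp
        (f := fun η : Fin (n + 1) → ℂ => (k - ∑ j, η j * u j, v + ∑ j, η j * w j))
        (by fun_prop)
    have hmeas := hcont.measurable.ennreal_ofReal
    rw [← mp.lintegral_comp hmeas, lintegral_prod_symm _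
      (show Measurable fun a => ENNReal.ofReal (gaussianDensityMoment A B C
        (k - ∑ j, (MeasurableEquiv.piFinSuccAbove (fun _ => ℂ) 0).symm a j * u j)
        (v + ∑ j, (MeasurableEquiv.piFinSuccAbove (fun _ => ℂ) 0).symm a j * w j)) from
        hmeas.comp (MeasurableEquiv.measurable _)).aemeasurable]
    have key : ∀ η : Fin n → ℂ, ∫⁻ x : ℂ, ENNReal.ofReal (gaussianDensityMoment A B C
        (k - ∑ j, (MeasurableEquiv.piFinSuccAbove (fun _ => ℂ) 0).symm (x, η) j * u j)
        (v + ∑ j, (MeasurableEquiv.piFinSuccAbove (fun _ => ℂ) 0).symm (x, η) j * w j))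
          ∂complexGaussian 0 1
        = ENNReal.ofReal (gaussianDensityMoment (A + ‖u 0‖ ^ 2)
          (B + w 0 * (starRingEnd ℂ) (u 0)) (C + ‖w 0‖ ^ 2)
            (k - ∑ j, η j * u j.succ) (v + ∑ j, η j * w j.succ)) := by
      intro η
      rw [← lintegral_gaussianDensityMoment hA hC]
      refine lintegral_congr fun x => ?_
      simp only [MeasurableEquiv.piFinSuccAbove_symm_apply, Fin.insertNthEquiv_zero,
        Fin.consEquiv_apply, Fin.sum_univ_succ, Fin.cons_zero, Fin.cons_succ]
      congr 2 <;> ring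
    have := ih hA' hC' k v (fun j => u j.succ) (fun j => w j.succ)
    simp_rw [key]
    rw [this]
    simp only [Fin.sum_univ_succ, add_assoc]

/-! ### Orthonormal polynomials and the Christoffel–Darboux formula -/

theorem integrable_of_continuous_of_circle {μ : Measure ℂ} [IsFiniteMeasure μ]
    (hμ : μ (Metric.sphere 0 1)ᶜ = 0) {f : ℂ → ℂ} (hf : Continuous f) : Integrable f μ := by
  have h : μ.restrict (Metric.sphere 0 1) = μ :=
    Measure.restrict_eq_self_of_ae_mem (mem_ae_iff.2 hμ)
  rw [← h]
  exact hf.continuousOn.integrableOn_compact (isCompact_sphere 0 1)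

/-- The Hermitian form `∫ p conj q dμ` on polynomials. -/
noncomputable def polyInner (μ : Measure ℂ) (p q : ℂ[X]) : ℂ :=
  ∫ ζ, p.eval ζ * conj (q.eval ζ) ∂μ

section
variable {μ : Measure ℂ}

theorem polyInner_sum_left [IsFiniteMeasure μ] (hμ : μ (Metric.sphere 0 1)ᶜ = 0) {ι : Type*} (s : Finset ι)
    (c : ι → ℂ) (p : ι → ℂ[X]) (q : ℂ[X]) :
    polyInner μ (∑ i ∈ s, C (c i) * p i) q = ∑ i ∈ s, c i * polyInner μ (p i) q := by
  simp only [polyInner, eval_finsetSum, eval_mul, eval_C, Finset.sum_mul]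
  rw [integral_finsetSum]
  · refine Finset.sum_congr rfl fun i _ => ?_
    rw [← integral_const_mul]
    congr 1; ext ζ; ring
  · intro i _
    exact integrable_of_continuous_of_circle hμ (by fun_prop)

theorem polyInner_conj (p q : ℂ[X]) : conj (polyInner μ p q) = polyInner μ q p := by
  rw [polyInner, ← integral_conj]
  simp [polyInner, mul_comm]

theorem polyInner_sum_right [IsFiniteMeasure μ] (hμ : μ (Metric.sphere 0 1)ᶜ = 0) {ι : Type*} (s : Finset ι)
    (c : ι → ℂ) (p : ι → ℂ[X]) (q : ℂ[X]) :
    polyInner μ q (∑ i ∈ s, C (c i) * p i) = ∑ i ∈ s, conj (c i) * polyInner μ q (p i) := by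
  rw [← polyInner_conj, polyInner_sum_left hμ, map_sum]
  simp [polyInner_conj]

theorem polyInner_congr_circle (hμ : μ (Metric.sphere 0 1)ᶜ = 0) {p q p' q' : ℂ[X]}
    (h : ∀ ζ : ℂ, ζ * conj ζ = 1 → p.eval ζ * conj (q.eval ζ) = p'.eval ζ * conj (q'.eval ζ)) :
    polyInner μ p q = polyInner μ p' q' := by
  refine integral_congr_ae ?_
  have : ∀ᵐ ζ ∂μ, ζ ∈ Metric.sphere (0 : ℂ) 1 := mem_ae_iff.2 hμ
  filter_upwards [this] with ζ hζ
  refine h ζ ?_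
  rw [mem_sphere_zero_iff_norm] at hζ
  rw [Complex.mul_conj', hζ]
  simp

variable {φ : ℕ → ℂ[X]}

theorem IsOrthonormalOnCircle.exists_eq_sum (hφ : IsOrthonormalOnCircle μ φ) {n : ℕ} {p : ℂ[X]}
    (hp : p.natDegree ≤ n) : ∃ c : Fin (n + 1) → ℂ, p = ∑ j, C (c j) * φ j := by
  let S : Polynomial.Sequence ℂ := ⟨φ, hφ.degree_eq⟩
  have hspan := S.span_degreeLE (m := n) fun i _ =>
    (leadingCoeff_ne_zero.2 (S.ne_zero i)).isUnit
  have hmem : p ∈ degreeLE ℂ n := mem_degreeLE.2 (natDegree_le_iff_degree_le.1 hp)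
  have hrange : (S : ℕ → ℂ[X]) '' Set.Iic n = Set.range fun j : Fin (n + 1) => φ j := by
    ext r
    constructor
    · rintro ⟨i, hi, rfl⟩
      exact ⟨⟨i, Nat.lt_succ_of_le hi⟩, rfl⟩
    · rintro ⟨j, rfl⟩
      exact ⟨j, Nat.le_of_lt_succ j.2, rfl⟩
  rw [← hspan, hrange, Submodule.mem_span_range_iff_exists_fun] at hmem
  obtain ⟨c, hc⟩ := hmem
  exact ⟨c, by rw [← hc]; simp [smul_eq_C_mul]⟩

theorem IsOrthonormalOnCircle.natDegree_eq (hφ : IsOrthonormalOnCircle μ φ) (n : ℕ) :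
    (φ n).natDegree = n :=
  natDegree_eq_of_degree_eq_some (hφ.degree_eq n)

theorem IsOrthonormalOnCircle.coeff_zero_ne_zero (hφ : IsOrthonormalOnCircle μ φ) :
    (φ 0).coeff 0 ≠ 0 := by
  have : (φ 0).leadingCoeff ≠ 0 := leadingCoeff_ne_zero.2
    (ne_zero_of_degree_gt (n := ⊥) (by rw [hφ.degree_eq]; exact WithBot.bot_lt_coe _))
  rwa [leadingCoeff, hφ.natDegree_eq] at this

theorem IsOrthonormalOnCircle.polyInner_eq (hφ : IsOrthonormalOnCircle μ φ) (m n : ℕ) :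
    polyInner μ (φ m) (φ n) = if m = n then 1 else 0 :=
  hφ.integral_eq m n

theorem IsOrthonormalOnCircle.polyInner_eq_zero_of_natDegree_lt [IsFiniteMeasure μ]
    (hφ : IsOrthonormalOnCircle μ φ) {n : ℕ} {p : ℂ[X]} (hp : p.natDegree ≤ n) :
    polyInner μ p (φ (n + 1)) = 0 := by
  obtain ⟨c, rfl⟩ := hφ.exists_eq_sum hp
  rw [polyInner_sum_left hφ.measure_compl_circle]
  refine Finset.sum_eq_zero fun j _ => ?_
  rw [hφ.polyInner_eq, if_neg (by omega), mul_zero]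

/-- The reproducing kernel of the polynomials of degree at most `n` does not depend on the
orthonormal basis. -/
theorem IsOrthonormalOnCircle.sum_eval_mul_conj_eval_eq [IsFiniteMeasure μ]
    (hφ : IsOrthonormalOnCircle μ φ) {n : ℕ} {f : Fin (n + 1) → ℂ[X]} (hdeg : ∀ i, (f i).natDegree ≤ n)
    (hf : ∀ i k, polyInner μ (f i) (f k) = if i = k then 1 else 0) (z w : ℂ) :
    ∑ i, (f i).eval z * conj ((f i).eval w)
      = ∑ j : Fin (n + 1), (φ j).eval z * conj ((φ j).eval w) := by
  choose c hc using fun i => hφ.exists_eq_sum (hdeg i)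
  let M : Matrix (Fin (n + 1)) (Fin (n + 1)) ℂ := Matrix.of c
  have hM : M * M.conjTranspose = 1 := by
    ext i k
    have h := hf i k
    rw [hc i, hc k, polyInner_sum_left hφ.measure_compl_circle] at h
    simp only [polyInner_sum_right hφ.measure_compl_circle, hφ.polyInner_eq, Fin.val_inj] at h
    rw [Matrix.mul_apply, Matrix.one_apply, ← h]
    simp [M, Matrix.conjTranspose_apply]
  -- The change of basis is a square matrix, so orthonormal rows force orthonormal columns.
  have hM' : M.conjTranspose * M = 1 := mul_eq_one_comm.1 hM
  have hcol : ∀ j k, ∑ i, c i j * conj (c i k) = if j = k then 1 else 0 := fun j k => by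
    have := congrFun (congrFun hM' k) j
    rw [Matrix.mul_apply, Matrix.one_apply] at this
    simp only [M, Matrix.conjTranspose_apply, Matrix.of_apply] at this
    simp only [eq_comm (a := j), ← this]
    exact Finset.sum_congr rfl fun i _ => mul_comm _ _
  calc ∑ i, (f i).eval z * conj ((f i).eval w)
      = ∑ i, ∑ j : Fin (n + 1), ∑ k : Fin (n + 1),
          (c i j * conj (c i k)) * ((φ j).eval z * conj ((φ k).eval w)) := by
        refine Finset.sum_congr rfl fun i _ => ?_
        rw [hc i]
        simp only [eval_finsetSum, eval_mul, eval_C, map_sum, map_mul, Finset.sum_mul_sum]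
        exact Finset.sum_congr rfl fun j _ => Finset.sum_congr rfl fun k _ => by ring
    _ = ∑ j : Fin (n + 1), ∑ k : Fin (n + 1), (∑ i, c i j * conj (c i k)) *
          ((φ j).eval z * conj ((φ k).eval w)) := by
        rw [Finset.sum_comm]
        refine Finset.sum_congr rfl fun j _ => ?_
        rw [Finset.sum_comm]
        simp only [Finset.sum_mul]
    _ = _ := by simp [hcol]

theorem natDegree_reversedPoly_le {n : ℕ} {p : ℂ[X]} (hp : p.natDegree ≤ n) :
    (reversedPoly n p).natDegree ≤ n := by
  refine natDegree_le_iff_coeff_eq_zero.2 fun k hk => ?_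
  rw [reversedPoly, coeff_reflect, revAt_eq_self_of_lt hk, coeff_map,
    coeff_eq_zero_of_natDegree_lt (hp.trans_lt hk), map_zero]

theorem eval_reversedPoly_of_mem_circle {n : ℕ} {p : ℂ[X]} (hp : p.natDegree ≤ n) {ζ : ℂ}
    (hζ : ζ * conj ζ = 1) : (reversedPoly n p).eval ζ = ζ ^ n * conj (p.eval ζ) := by
  have h0 : conj ζ ≠ 0 := right_ne_zero_of_mul_eq_one hζ
  rw [eval_reversedPoly hp (left_ne_zero_of_mul_eq_one hζ), ← eq_div_of_mul_eq h0 hζ]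

/-- The Christoffel–Darboux formula on the unit circle. -/
theorem IsOrthonormalOnCircle.christoffel_darboux [IsFiniteMeasure μ]
    (hφ : IsOrthonormalOnCircle μ φ) (N : ℕ) (z w : ℂ) :
    (∑ j : Fin (N + 1), (φ j).eval z * conj ((φ j).eval w)) * (1 - z * conj w)
      = (reversedPoly (N + 1) (φ (N + 1))).eval z
          * conj ((reversedPoly (N + 1) (φ (N + 1))).eval w)
        - (φ (N + 1)).eval z * conj ((φ (N + 1)).eval w) := by
  have hμ := hφ.measure_compl_circle
  have hd : (φ (N + 1)).natDegree ≤ N + 1 := (hφ.natDegree_eq _).le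
  set q := reversedPoly (N + 1) (φ (N + 1)) with hq
  have hXX : ∀ i k, polyInner μ (X * φ i) (X * φ k) = if i = k then 1 else 0 := fun i k => by
    rw [← hφ.polyInner_eq]
    refine polyInner_congr_circle hμ fun ζ hζ => ?_
    simp only [eval_mul, eval_X, map_mul]
    linear_combination (eval ζ (φ i) * conj (eval ζ (φ k))) * hζ
  have hqq : polyInner μ q q = 1 := by
    rw [← (hφ.polyInner_eq (N + 1) (N + 1)).trans (if_pos rfl)]
    refine polyInner_congr_circle hμ fun ζ hζ => ?_
    rw [hq, eval_reversedPoly_of_mem_circle hd hζ]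
    have : ζ ^ (N + 1) * conj ζ ^ (N + 1) = 1 := by rw [← mul_pow, hζ, one_pow]
    simp only [map_mul, map_pow, Complex.conj_conj]
    linear_combination (eval ζ (φ (N + 1)) * conj (eval ζ (φ (N + 1)))) * this
  -- On the circle q conj(ζ φ_i) equals r conj(φ_{N+1}), where r is φ_i reversed in degree N; r has
  -- degree at most N and so is orthogonal to φ_{N+1}.
  have hqX : ∀ i ≤ N, polyInner μ q (X * φ i) = 0 := fun i hi => by
    have hi' : (φ i).natDegree ≤ N := (hφ.natDegree_eq i).trans_le hi
    rw [← hφ.polyInner_eq_zero_of_natDegree_lt (natDegree_reversedPoly_le hi')]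
    refine polyInner_congr_circle hμ fun ζ hζ => ?_
    rw [hq, eval_reversedPoly_of_mem_circle hd hζ, eval_reversedPoly_of_mem_circle hi' hζ]
    simp only [map_mul, eval_mul, eval_X]
    linear_combination (ζ ^ N * conj (eval ζ (φ (N + 1))) * conj (eval ζ (φ i))) * hζ
  -- A second orthonormal basis of the polynomials of degree at most N + 1: zφ_0, …, zφ_N and the
  -- reverse of φ_{N+1}. Equating its kernel with that of φ_0, …, φ_{N+1} gives the formula.
  let f : Fin (N + 2) → ℂ[X] := Fin.snoc (fun j : Fin (N + 1) => X * φ j) q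
  have hdeg : ∀ i, (f i).natDegree ≤ N + 1 := fun i => by
    refine Fin.lastCases ?_ (fun j => ?_) i
    · simpa [f] using natDegree_reversedPoly_le hd
    · simp only [f, Fin.snoc_castSucc]
      refine natDegree_mul_le.trans ?_
      rw [natDegree_X, hφ.natDegree_eq]
      omega
  have hf : ∀ i k, polyInner μ (f i) (f k) = if i = k then 1 else 0 := fun i k => by
    refine Fin.lastCases ?_ (fun i => ?_) i <;> refine Fin.lastCases ?_ (fun k => ?_) k
    · simpa [f] using hqq
    · simp only [f, Fin.snoc_castSucc, Fin.snoc_last]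
      rw [hqX k (by omega), if_neg (Fin.castSucc_lt_last k).ne']
    · simp only [f, Fin.snoc_castSucc, Fin.snoc_last]
      rw [← polyInner_conj, hqX i (by omega), if_neg (Fin.castSucc_lt_last i).ne, map_zero]
    · simp only [f, Fin.snoc_castSucc]
      rw [hXX]
      simp [Fin.ext_iff]
  have key := hφ.sum_eval_mul_conj_eval_eq hdeg hf z w
  rw [Fin.sum_univ_castSucc, Fin.sum_univ_castSucc (n := N + 1)] at key
  simp only [f, Fin.snoc_castSucc, Fin.snoc_last, eval_mul, eval_X, map_mul, Fin.val_castSucc,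
    Fin.val_last] at key
  have hs : ∑ j : Fin (N + 1), z * eval z (φ j) * (conj w * conj (eval w (φ j)))
      = z * conj w * ∑ j : Fin (N + 1), (φ j).eval z * conj ((φ j).eval w) := by
    rw [Finset.mul_sum]
    exact Finset.sum_congr rfl fun j _ => by ring
  rw [hs] at key
  linear_combination -key

end

/-! ### Derivatives of the kernel and the closed form -/

section
variable {n : ℕ} {f : Fin n → ℂ[X]} {p q : ℂ[X]}

/-- With w frozen the kernel identity is one between polynomials in z, so it may be differentiated
in z. -/
theorem kernel_deriv_left
    (h : ∀ z w : ℂ, (∑ j, (f j).eval z * conj ((f j).eval w)) * (1 - z * conj w)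
      = q.eval z * conj (q.eval w) - p.eval z * conj (p.eval w)) (z w : ℂ) :
    (∑ j, (derivative (f j)).eval z * conj ((f j).eval w)) * (1 - z * conj w)
        - conj w * ∑ j, (f j).eval z * conj ((f j).eval w)
      = (derivative q).eval z * conj (q.eval w) - (derivative p).eval z * conj (p.eval w) := by
  have h1 : (∑ j, f j * C (conj ((f j).eval w))) * (1 - X * C (conj w))
      = q * C (conj (q.eval w)) - p * C (conj (p.eval w)) := by
    refine Polynomial.funext fun x => ?_
    simpa [eval_finsetSum, mul_comm x] using h x w
  have h2 := congrArg (fun r => (derivative r).eval z) h1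
  simp [eval_finsetSum] at h2
  linear_combination h2

/-- Conjugating the first derivative makes it polynomial in the second variable, which is then
differentiated; hence z and w trade places. -/
theorem kernel_deriv_left_right
    (h : ∀ z w : ℂ, (∑ j, (f j).eval z * conj ((f j).eval w)) * (1 - z * conj w)
      = q.eval z * conj (q.eval w) - p.eval z * conj (p.eval w)) (z w : ℂ) :
    (∑ j, (derivative (f j)).eval w * conj ((derivative (f j)).eval z)) * (1 - w * conj z)
        - conj z * (∑ j, (f j).eval w * conj ((derivative (f j)).eval z))
        - (∑ j, (f j).eval w * conj ((f j).eval z))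
        - w * (∑ j, (derivative (f j)).eval w * conj ((f j).eval z))
      = (derivative q).eval w * conj ((derivative q).eval z)
        - (derivative p).eval w * conj ((derivative p).eval z) := by
  have h1 : (∑ j, f j * C (conj ((derivative (f j)).eval z))) * (1 - X * C (conj z))
        - X * ∑ j, f j * C (conj ((f j).eval z))
      = q * C (conj ((derivative q).eval z)) - p * C (conj ((derivative p).eval z)) := by
    refine Polynomial.funext fun x => ?_
    have := congrArg conj (kernel_deriv_left h z x)
    simp only [map_sub, map_mul, map_sum, Complex.conj_conj, map_one] at this
    simp only [eval_finsetSum, eval_sub, eval_mul, eval_C, eval_X, eval_one]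
    simp only [mul_comm (eval x _)]
    rw [mul_comm x (conj z)]
    exact this
  have h2 := congrArg (fun r => (derivative r).eval w) h1
  simp [eval_finsetSum] at h2
  linear_combination h2

end

theorem gaussianDensityMoment_eq_of_kernel {A C : ℝ} {B z q p q' p' : ℂ} (K₁ K₂ : ℝ) (hA : 0 < A)
    (hz : ‖z‖ ≠ 1) (h0 : A * (1 - z * conj z) = q * conj q - p * conj p)
    (h1 : B * (1 - z * conj z) - conj z * A = q' * conj q - p' * conj p)
    (h2 : C * (1 - z * conj z) - conj z * conj B - A - z * B = q' * conj q' - p' * conj p') :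
    gaussianDensityMoment A B C (K₁ + K₂ * Complex.I) 0
      = 1 / Real.pi
        * Real.exp (-((K₁ ^ 2 + K₂ ^ 2) / 2
            * ((1 - ‖z‖ ^ 2) / (‖q‖ ^ 2 - ‖p‖ ^ 2))))
        * (1 / (1 - ‖z‖ ^ 2) ^ 2 - ‖q * p' - q' * p‖ ^ 2 / (‖q‖ ^ 2 - ‖p‖ ^ 2) ^ 2
          + (K₁ ^ 2 + K₂ ^ 2) / 2
            * ((1 - ‖z‖ ^ 2) * ‖conj q' * q - conj p' * p‖ ^ 2 / (‖q‖ ^ 2 - ‖p‖ ^ 2) ^ 3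
              + 2 * (z * (q' * conj q - p' * conj p)).re / (‖q‖ ^ 2 - ‖p‖ ^ 2) ^ 2
              + ‖z‖ ^ 2 / ((1 - ‖z‖ ^ 2) * (‖q‖ ^ 2 - ‖p‖ ^ 2)))) := by
  set t := 1 - ‖z‖ ^ 2 with ht
  have ht0 : t ≠ 0 := by
    intro h
    exact hz ((pow_eq_one_iff_of_nonneg (norm_nonneg z) two_ne_zero).1 (by linarith))
  have htz : 1 - z * conj z = (t : ℂ) := by
    rw [Complex.mul_conj', ht]; push_cast; ring
  rw [htz] at h0 h1 h2
  have hD : ‖q‖ ^ 2 - ‖p‖ ^ 2 = t * A := by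
    apply Complex.ofReal_injective
    push_cast
    simp only [← Complex.mul_conj']
    linear_combination -h0
  have hzB : z * B + conj z * conj B = ((2 * (z * B).re : ℝ) : ℂ) := by
    rw [← map_mul, Complex.add_conj]
  have hE : ‖conj q' * q - conj p' * p‖ ^ 2
      = t ^ 2 * ‖B‖ ^ 2 - 2 * t * A * (z * B).re + ‖z‖ ^ 2 * A ^ 2 := by
    have e : conj q' * q - conj p' * p = conj (B * t - conj z * A) := by
      rw [h1]; simp
    rw [e]
    apply Complex.ofReal_injective
    push_cast
    simp only [← Complex.mul_conj', map_sub, map_mul, Complex.conj_conj, Complex.conj_ofReal]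
    have hzB' := hzB
    push_cast at hzB'
    linear_combination (-(t : ℂ) * A) * hzB'
  have hre : (z * (q' * conj q - p' * conj p)).re = t * (z * B).re - ‖z‖ ^ 2 * A := by
    rw [← h1]
    have e : z * (B * t - conj z * A) = (t : ℂ) * (z * B) - ((‖z‖ ^ 2 * A : ℝ) : ℂ) := by
      push_cast
      rw [← Complex.mul_conj']; ring
    rw [e, Complex.sub_re, Complex.re_ofReal_mul, Complex.ofReal_re]
  -- A Lagrange identity of signature (1,1): the second factor subtracted is |q'|² - |p'|², and t A
  -- is |q|² - |p|².
  have hW : ‖q * p' - q' * p‖ ^ 2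
      = ‖conj q' * q - conj p' * p‖ ^ 2 - t * A * (C * t - 2 * (z * B).re - A) := by
    apply Complex.ofReal_injective
    push_cast
    simp only [← Complex.mul_conj', map_sub, map_mul, Complex.conj_conj]
    have hzB' := hzB
    push_cast at hzB'
    have h2' : (C : ℂ) * t - 2 * ((z * B).re : ℂ) - A = q' * conj q' - p' * conj p' := by
      rw [← h2]; linear_combination hzB'
    have h0' : (t : ℂ) * A = q * conj q - p * conj p := by rw [← h0]; ring
    rw [h2', h0']
    ring
  have hK : ‖(K₁ + K₂ * Complex.I : ℂ)‖ ^ 2 = K₁ ^ 2 + K₂ ^ 2 := by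
    rw [← Complex.normSq_eq_norm_sq, Complex.normSq_add_mul_I]
  have hKB : ‖0 + (K₁ + K₂ * Complex.I : ℂ) * B / A‖ ^ 2
      = (K₁ ^ 2 + K₂ ^ 2) * ‖B‖ ^ 2 / A ^ 2 := by
    rw [zero_add, norm_div, norm_mul, div_pow, mul_pow, hK, Complex.norm_real, Real.norm_eq_abs,
      sq_abs]
  rw [gaussianDensityMoment, complexGaussianPDF, sub_zero, hK, hKB, hD, hW, hE, hre]
  have hexp : (K₁ ^ 2 + K₂ ^ 2) / (2 * A) = (K₁ ^ 2 + K₂ ^ 2) / 2 * (t / (t * A)) := by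
    field_simp
  rw [hexp]
  have hz2 : ‖z‖ ^ 2 = 1 - t := by rw [ht]; ring
  rw [hz2]
  have hA0 := hA.ne'
  have hpi := Real.pi_ne_zero
  generalize Real.exp _ = ex
  field_simp
  ring

/-! ### The expected density of the random sum -/

theorem norm_sq_sum_mul_conj_le {n : ℕ} (u w : Fin n → ℂ) :
    ‖∑ j, w j * conj (u j)‖ ^ 2 ≤ (∑ j, ‖u j‖ ^ 2) * ∑ j, ‖w j‖ ^ 2 := by
  have h1 : ‖∑ j, w j * conj (u j)‖ ≤ ∑ j, ‖u j‖ * ‖w j‖ := by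
    refine (norm_sum_le _ _).trans_eq (Finset.sum_congr rfl fun j _ => ?_)
    rw [norm_mul, RCLike.norm_conj, mul_comm]
  exact (pow_le_pow_left₀ (norm_nonneg _) h1 2).trans (Finset.sum_mul_sq_le_sq_mul_sq _ _ _)

/-- The expected density of the solutions of `∑ j, η j * f j z = K`. -/
noncomputable def gaussianZeroDensity {n : ℕ} (f : Fin n → ℂ[X]) (K z : ℂ) : ℝ :=
  gaussianDensityMoment (∑ j, ‖(f j).eval z‖ ^ 2)
    (∑ j, (derivative (f j)).eval z * conj ((f j).eval z))
    (∑ j, ‖(derivative (f j)).eval z‖ ^ 2) K 0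

section
variable {n : ℕ} {f : Fin (n + 1) → ℂ[X]} {c : ℂ}

theorem sum_norm_sq_eval_pos (hc : c ≠ 0) (hf : f 0 = C c) (z : ℂ) :
    0 < ∑ j, ‖(f j).eval z‖ ^ 2 := by
  refine Finset.sum_pos' (fun _ _ => by positivity) ⟨0, Finset.mem_univ _, ?_⟩
  rw [hf, eval_C]
  positivity

theorem gaussianZeroDensity_nonneg (hc : c ≠ 0) (hf : f 0 = C c) (K z : ℂ) :
    0 ≤ gaussianZeroDensity f K z := by
  have hA := sum_norm_sq_eval_pos hc hf z
  have h := norm_sq_sum_mul_conj_le (fun j => (f j).eval z) fun j => (derivative (f j)).eval z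
  refine mul_nonneg (complexGaussianPDF_nonneg _ hA.le _) ?_
  have : 0 ≤ ∑ j, ‖(derivative (f j)).eval z‖ ^ 2
      - ‖∑ j, (derivative (f j)).eval z * conj ((f j).eval z)‖ ^ 2 / ∑ j, ‖(f j).eval z‖ ^ 2 := by
    rw [sub_nonneg, div_le_iff₀' hA]
    exact h
  positivity

theorem continuous_gaussianZeroDensity (hc : c ≠ 0) (hf : f 0 = C c) (K : ℂ) :
    Continuous (gaussianZeroDensity f K) := by
  have hA0 : ∀ z, ∑ j, ‖(f j).eval z‖ ^ 2 ≠ 0 := fun z => (sum_norm_sq_eval_pos hc hf z).ne'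
  have hA0' : ∀ z, ((∑ j, ‖(f j).eval z‖ ^ 2 : ℝ) : ℂ) ≠ 0 := fun z =>
    Complex.ofReal_ne_zero.2 (hA0 z)
  have hA : Continuous fun z => ∑ j, ‖(f j).eval z‖ ^ 2 := by fun_prop
  have hB : Continuous fun z => ∑ j, (derivative (f j)).eval z * conj ((f j).eval z) := by fun_prop
  have hC : Continuous fun z => ∑ j, ‖(derivative (f j)).eval z‖ ^ 2 := by fun_prop
  unfold gaussianZeroDensity gaussianDensityMoment complexGaussianPDF
  refine Continuous.mul (Continuous.div (Real.continuous_exp.comp (Continuous.neg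
    (Continuous.div continuous_const (hA.const_mul 2) ?_))) (hA.const_mul _) ?_) ?_
  · exact fun z => mul_ne_zero two_ne_zero (hA0 z)
  · exact fun z => mul_ne_zero (by positivity) (hA0 z)
  · refine Continuous.add ((continuous_norm.comp (continuous_const.add
      (Continuous.div (hB.const_mul K) (Complex.continuous_ofReal.comp hA) hA0'))).pow 2)
      ((hC.sub (((continuous_norm.comp hB).pow 2).div hA hA0)).const_mul 2)

/-- Solving the equation for the coefficient x of the constant f 0 turns zeros into preimages of x
under a polynomial F not involving x; the area formula then applies. -/
theorem lintegral_zeroCount_cons (hc : c ≠ 0) (hf : f 0 = C c) (K : ℂ) {Φ : Set ℂ}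
    (hΦ : MeasurableSet Φ) (η : Fin n → ℂ)
    (hm : Measurable fun x : ℂ =>
      zeroCount (fun z => ∑ j, (Fin.cons x η : Fin (n + 1) → ℂ) j * (f j).eval z) K Φ) :
    ∫⁻ x, zeroCount (fun z => ∑ j, (Fin.cons x η : Fin (n + 1) → ℂ) j * (f j).eval z) K Φ
        ∂complexGaussian 0 1
      = ∫⁻ z in Φ, ENNReal.ofReal (gaussianDensityMoment (‖c‖ ^ 2) 0 0
          (K - ∑ j, η j * (f j.succ).eval z) (0 + ∑ j, η j * (derivative (f j.succ)).eval z)) := by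
  let F : ℂ[X] := C c⁻¹ * (C K - ∑ j, C (η j) * f j.succ)
  have hFe : ∀ z, F.eval z = c⁻¹ * (K - ∑ j, η j * (f j.succ).eval z) := fun z => by
    simp [F, eval_finsetSum]
  have hFd : ∀ z, deriv (fun z => F.eval z) z
      = c⁻¹ * -∑ j, η j * (derivative (f j.succ)).eval z := fun z => by
    rw [Polynomial.deriv]
    simp [F, eval_finsetSum]
  have hcount : ∀ x, zeroCount (fun z => ∑ j, (Fin.cons x η : Fin (n + 1) → ℂ) j * (f j).eval z)
      K Φ = zeroCount (fun z => F.eval z) x Φ := fun x => by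
    rw [zeroCount, zeroCount]
    congr 3
    ext z
    simp only [Set.mem_ofPred_eq, Fin.sum_univ_succ, Fin.cons_zero, Fin.cons_succ, hf, eval_C, hFe]
    rw [inv_mul_eq_iff_eq_mul₀ hc]
    constructor <;> intro h <;> linear_combination -h
  rw [lintegral_complexGaussian one_ne_zero hm]
  simp_rw [hcount, mul_comm (ENNReal.ofReal _)]
  rw [lintegral_zeroCount_mul (F.differentiable) hΦ
    (continuous_complexGaussianPDF _ _).measurable.ennreal_ofReal]
  refine lintegral_congr fun z => ?_
  rw [← ENNReal.ofReal_mul (by positivity), hFd, hFe]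
  congr 1
  have hcn : ‖c‖ ≠ 0 := norm_ne_zero_iff.2 hc
  simp only [gaussianDensityMoment, complexGaussianPDF, sub_zero, norm_mul, norm_inv, norm_neg,
    mul_zero, zero_div, add_zero, zero_add, norm_zero, NNReal.coe_one, mul_pow, inv_pow]
  rw [show (‖c‖ ^ 2)⁻¹ * ‖K - ∑ j, η j * (f j.succ).eval z‖ ^ 2 / (2 * 1)
    = ‖K - ∑ j, η j * (f j.succ).eval z‖ ^ 2 / (2 * ‖c‖ ^ 2) by field_simp]
  field_simp
  ring

theorem continuous_uncurry_sum_mul_eval {m : ℕ} (g : Fin m → ℂ[X]) : Continuous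
    (Function.uncurry fun (η : Fin m → ℂ) (z : ℂ) => ∑ j, η j * (g j).eval z) := by
  unfold Function.uncurry
  fun_prop

theorem lintegral_zeroCount_pi (hc : c ≠ 0) (hf : f 0 = C c) (K : ℂ) {Φ : Set ℂ}
    (hΦ : IsCompact Φ) :
    ∫⁻ η : Fin (n + 1) → ℂ, zeroCount (fun z => ∑ j, η j * (f j).eval z) K Φ
        ∂Measure.pi (fun _ => complexGaussian 0 1)
      = ∫⁻ z in Φ, ENNReal.ofReal (gaussianZeroDensity f K z) := by
  have mp := (measurePreserving_piFinSuccAbove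
    (fun _ : Fin (n + 1) => complexGaussian 0 1) 0).symm
  have hmeas := measurable_zeroCount (continuous_uncurry_sum_mul_eval f) K hΦ
  have hm2 : Measurable fun p : ℂ × (Fin n → ℂ) => zeroCount (fun z => ∑ j,
      (MeasurableEquiv.piFinSuccAbove (fun _ => ℂ) 0).symm p j * (f j).eval z) K Φ :=
    hmeas.comp (MeasurableEquiv.measurable _)
  rw [← mp.lintegral_comp hmeas, lintegral_prod_symm _ hm2.aemeasurable]
  simp only [MeasurableEquiv.piFinSuccAbove_symm_apply, Fin.insertNthEquiv_zero,
    Fin.consEquiv_apply] at hm2 ⊢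
  have hm3 : ∀ η : Fin n → ℂ, Measurable fun x : ℂ =>
      zeroCount (fun z => ∑ j, (Fin.cons x η : Fin (n + 1) → ℂ) j * (f j).eval z) K Φ := fun η =>
    hm2.comp (f := fun x : ℂ => (x, η)) (by fun_prop)
  simp_rw [lintegral_zeroCount_cons hc hf K hΦ.measurableSet _ (hm3 _)]
  have hm4 : Measurable fun p : (Fin n → ℂ) × ℂ => ENNReal.ofReal
      (gaussianDensityMoment (‖c‖ ^ 2) 0 0 (K - ∑ j, p.1 j * (f j.succ).eval p.2)
        (0 + ∑ j, p.1 j * (derivative (f j.succ)).eval p.2)) := by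
    refine Continuous.measurable ?_ |>.ennreal_ofReal
    exact (continuous_gaussianDensityMoment _ _ _).comp
      (f := fun p : (Fin n → ℂ) × ℂ => (K - ∑ j, p.1 j * (f j.succ).eval p.2,
        0 + ∑ j, p.1 j * (derivative (f j.succ)).eval p.2)) (by fun_prop)
  rw [lintegral_lintegral_swap hm4.aemeasurable]
  refine lintegral_congr fun z => ?_
  -- The constant term starts the recursion at A = |c|² > 0, B = C = 0, so no degenerate covariance
  -- of the value occurs.
  rw [lintegral_pi_gaussianDensityMoment n (by positivity) (by simp)]
  simp [gaussianZeroDensity, Fin.sum_univ_succ, hf]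

end

/-! ### Law of the coefficients, uniqueness and conclusion -/

theorem map_pi_complexGaussian {Ω : Type*} [MeasurableSpace Ω] {P : Measure Ω}
    [IsProbabilityMeasure P] {n : ℕ} {a b : Fin n → Ω → ℝ}
    (ha : ∀ j, HasLaw (a j) (gaussianReal 0 1) P) (hb : ∀ j, HasLaw (b j) (gaussianReal 0 1) P)
    (hind : iIndepFun (Sum.elim a b) P) :
    P.map (fun ω j => (a j ω : ℂ) + (b j ω : ℂ) * Complex.I)
      = Measure.pi fun _ => complexGaussian 0 1 := by
  have hlaw : ∀ i, HasLaw (Sum.elim a b i) (gaussianReal 0 1) P := by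
    rintro (j | j)
    · exact ha j
    · exact hb j
  have h1 := (iIndepFun_iff_map_fun_eq_pi_map fun i => (hlaw i).aemeasurable).1 hind
  rw [show (fun i => P.map (Sum.elim a b i)) = fun _ => gaussianReal 0 1 from
    funext fun i => (hlaw i).map_eq] at h1
  have m1 := measurePreserving_sumPiEquivProdPi
    (fun _ : Fin n ⊕ Fin n => gaussianReal 0 1)
  have m2 := (measurePreserving_arrowProdEquivProdArrow ℝ ℝ (Fin n) (fun _ => gaussianReal 0 1)
    (fun _ => gaussianReal 0 1)).symm
  have m3 := m2.comp m1
  have hX : AEMeasurable (fun ω i => Sum.elim a b i ω) P :=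
    aemeasurable_pi_lambda _ fun i => (hlaw i).aemeasurable
  have hprob : SigmaFinite (((gaussianReal 0 1).prod (gaussianReal 0 1)).map
      Complex.measurableEquivRealProd.symm) :=
    inferInstanceAs (SigmaFinite (complexGaussian 0 1))
  have h4 : (Measure.pi fun _ : Fin n => (gaussianReal 0 1).prod (gaussianReal 0 1)).map
      (fun x i => Complex.measurableEquivRealProd.symm (x i))
      = Measure.pi fun _ => complexGaussian 0 1 :=
    Measure.pi_map_pi fun _ => Complex.measurableEquivRealProd.symm.measurable.aemeasurable
  have h5 : Measurable fun (x : Fin n → ℝ × ℝ) i => Complex.measurableEquivRealProd.symm (x i) :=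
    measurable_pi_lambda _ fun i =>
      Complex.measurableEquivRealProd.symm.measurable.comp (measurable_pi_apply i)
  rw [← h4, ← m3.map_eq, ← h1, AEMeasurable.map_map_of_aemeasurable m3.measurable.aemeasurable hX,
    AEMeasurable.map_map_of_aemeasurable h5.aemeasurable (m3.measurable.comp_aemeasurable hX)]
  congr 1
  ext ω j
  apply Complex.ext <;> simp [MeasurableEquiv.arrowProdEquivProdArrow,
    MeasurableEquiv.sumPiEquivProdPi, Equiv.arrowProdEquivProdArrow, Equiv.sumPiEquivProdPi]

theorem IsExpectedZeroDensity.unique {Ω : Type*} [MeasurableSpace Ω] {P : Measure Ω}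
    {S : Ω → ℂ → ℂ} {K : ℂ} {h h' : ℂ → ℝ} (hh : IsExpectedZeroDensity P S K h)
    (hh' : IsExpectedZeroDensity P S K h') : h = h' := by
  have key : ∀ {g g' : ℂ → ℝ}, IsExpectedZeroDensity P S K g → IsExpectedZeroDensity P S K g' →
      ∀ z, g' z ≤ g z := by
    intro g g' hg hg' z
    by_contra! hlt
    obtain ⟨c₁, h1, h2⟩ := exists_between hlt
    -- Two levels g z < c₁ < c₂ < g' z: on a small closed ball the two integrals are then separated
    -- by c₁ and c₂ times its volume.
    obtain ⟨c₂, h3, h4⟩ := exists_between h2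
    have hev : ∀ᶠ w in nhds z, g w < c₁ ∧ c₂ < g' w :=
      (hg.continuous.continuousAt.eventually_lt_const h1).and
        (hg'.continuous.continuousAt.eventually_const_lt h4)
    obtain ⟨r, hr, hball⟩ := Metric.nhds_basis_closedBall.eventually_iff.1 hev
    have hcpt := isCompact_closedBall z r
    have hpos : volume (Metric.closedBall z r) ≠ 0 :=
      (Metric.measure_closedBall_pos volume z hr).ne'
    have e1 := hg.expectation_eq _ hcpt
    rw [hg'.expectation_eq _ hcpt] at e1
    have le1 : ∫⁻ w in Metric.closedBall z r, ENNReal.ofReal (g w)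
        ≤ ENNReal.ofReal c₁ * volume (Metric.closedBall z r) := by
      rw [← setLIntegral_const]
      exact setLIntegral_mono measurable_const fun w hw => ENNReal.ofReal_le_ofReal (hball hw).1.le
    have le2 : ENNReal.ofReal c₂ * volume (Metric.closedBall z r)
        ≤ ∫⁻ w in Metric.closedBall z r, ENNReal.ofReal (g' w) := by
      rw [← setLIntegral_const]
      exact setLIntegral_mono hg'.continuous.measurable.ennreal_ofReal
        fun w hw => ENNReal.ofReal_le_ofReal (hball hw).2.le
    have hle := (le2.trans e1.le).trans le1
    rw [ENNReal.mul_le_mul_iff_left hpos hcpt.measure_ne_top,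
      ENNReal.ofReal_le_ofReal_iff ((hg.nonneg z).trans h1.le)] at hle
    exact absurd h3 hle.not_gt
  exact funext fun z => le_antisymm (key hh' hh z) (key hh hh' z)

theorem isExpectedZeroDensity_gaussianZeroDensity {Ω : Type*} [MeasurableSpace Ω] {P : Measure Ω}
    [IsProbabilityMeasure P] {n : ℕ} {a b : Fin (n + 1) → Ω → ℝ}
    (ha : ∀ j, HasLaw (a j) (gaussianReal 0 1) P) (hb : ∀ j, HasLaw (b j) (gaussianReal 0 1) P)
    (hind : iIndepFun (Sum.elim a b) P) {f : Fin (n + 1) → ℂ[X]} {c : ℂ} (hc : c ≠ 0)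
    (hf : f 0 = C c) (K : ℂ) :
    IsExpectedZeroDensity P (randomSum a b fun j z => (f j).eval z) K
      (gaussianZeroDensity f K) := by
  have hη : AEMeasurable (fun ω j => (a j ω : ℂ) + (b j ω : ℂ) * Complex.I) P :=
    aemeasurable_pi_lambda _ fun j => (Complex.measurable_ofReal.comp_aemeasurable
      (ha j).aemeasurable).add ((Complex.measurable_ofReal.comp_aemeasurable
        (hb j).aemeasurable).mul_const _)
  have hm : ∀ Φ : Set ℂ, IsCompact Φ → Measurable fun η : Fin (n + 1) → ℂ =>
      zeroCount (fun z => ∑ j, η j * (f j).eval z) K Φ := fun Φ hΦ =>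
    measurable_zeroCount (continuous_uncurry_sum_mul_eval f) K hΦ
  refine ⟨continuous_gaussianZeroDensity hc hf K, gaussianZeroDensity_nonneg hc hf K,
    fun Φ hΦ => (hm Φ hΦ).comp_aemeasurable hη, fun Φ hΦ => ?_⟩
  rw [← lintegral_zeroCount_pi hc hf K hΦ, ← map_pi_complexGaussian ha hb hind,
    lintegral_map' (hm Φ hΦ).aemeasurable hη]
  rfl

theorem IsOrthonormalOnCircle.gaussianZeroDensity_eq {μ : Measure ℂ} [IsFiniteMeasure μ]
    {φ : ℕ → ℂ[X]} (hφ : IsOrthonormalOnCircle μ φ) {N : ℕ} {p q : ℂ[X]} (hp : p = φ (N + 1))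
    (hq : q = reversedPoly (N + 1) p) (K₁ K₂ : ℝ) {z : ℂ} (hz : ‖z‖ ≠ 1) :
    gaussianZeroDensity (fun j : Fin (N + 1) => φ j) (K₁ + K₂ * Complex.I) z
      = 1 / Real.pi
        * Real.exp (-((K₁ ^ 2 + K₂ ^ 2) / 2
            * ((1 - ‖z‖ ^ 2) / (‖q.eval z‖ ^ 2 - ‖p.eval z‖ ^ 2))))
        * (1 / (1 - ‖z‖ ^ 2) ^ 2
          - ‖q.eval z * (derivative p).eval z - (derivative q).eval z * p.eval z‖ ^ 2
              / (‖q.eval z‖ ^ 2 - ‖p.eval z‖ ^ 2) ^ 2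
          + (K₁ ^ 2 + K₂ ^ 2) / 2
            * ((1 - ‖z‖ ^ 2)
                  * ‖conj ((derivative q).eval z) * q.eval z
                      - conj ((derivative p).eval z) * p.eval z‖ ^ 2
                  / (‖q.eval z‖ ^ 2 - ‖p.eval z‖ ^ 2) ^ 3
              + 2 * (z * ((derivative q).eval z * conj (q.eval z)
                      - (derivative p).eval z * conj (p.eval z))).re
                  / (‖q.eval z‖ ^ 2 - ‖p.eval z‖ ^ 2) ^ 2
              + ‖z‖ ^ 2
                  / ((1 - ‖z‖ ^ 2) * (‖q.eval z‖ ^ 2 - ‖p.eval z‖ ^ 2)))) := by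
  subst hq hp
  have h := hφ.christoffel_darboux N
  have h1 := kernel_deriv_left (f := fun j : Fin (N + 1) => φ j) h z z
  have h2 := kernel_deriv_left_right (f := fun j : Fin (N + 1) => φ j) h z z
  have h0 := hφ.coeff_zero_ne_zero
  have hAc : ((∑ j : Fin (N + 1), ‖(φ j).eval z‖ ^ 2 : ℝ) : ℂ)
      = ∑ j : Fin (N + 1), (φ j).eval z * conj ((φ j).eval z) := by
    push_cast
    simp only [Complex.mul_conj']
  have hCc : ((∑ j : Fin (N + 1), ‖(derivative (φ j)).eval z‖ ^ 2 : ℝ) : ℂ)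
      = ∑ j : Fin (N + 1), (derivative (φ j)).eval z * conj ((derivative (φ j)).eval z) := by
    push_cast
    simp only [Complex.mul_conj']
  refine gaussianDensityMoment_eq_of_kernel K₁ K₂ (sum_norm_sq_eval_pos h0 ?_ z) hz ?_ ?_ ?_
  · exact eq_C_of_natDegree_eq_zero (hφ.natDegree_eq 0)
  · rw [hAc]; exact h z z
  · rw [hAc]; exact h1
  · rw [hAc, hCc, ← h2, map_sum]
    simp only [map_mul, Complex.conj_conj, mul_comm (conj (eval z (derivative _)))]

theorem theorem10 {Ω : Type*} [MeasurableSpace Ω] (P : Measure Ω) [IsProbabilityMeasure P]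
    (N : ℕ) (hN : 0 < N) (a b : Fin (N + 1) → Ω → ℝ)
    (ha : ∀ j, HasLaw (a j) (gaussianReal 0 1) P)
    (hb : ∀ j, HasLaw (b j) (gaussianReal 0 1) P)
    (hind : iIndepFun (Sum.elim a b) P)
    (μ : Measure ℂ) [IsFiniteMeasure μ] (φ : ℕ → ℂ[X]) (hφ : IsOrthonormalOnCircle μ φ)
    (K₁ K₂ : ℝ) (p q : ℂ[X]) (hp : p = φ (N + 1)) (hq : q = reversedPoly (N + 1) p) :
    (∃ h : ℂ → ℝ, IsExpectedZeroDensity P (randomSum a b fun j z => (φ j).eval z)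
      (K₁ + K₂ * Complex.I) h) ∧
    ∀ h : ℂ → ℝ, IsExpectedZeroDensity P (randomSum a b fun j z => (φ j).eval z)
      (K₁ + K₂ * Complex.I) h →
      ∀ z : ℂ, ‖z‖ ≠ 1 →
        h z = 1 / Real.pi
            * Real.exp (-((K₁ ^ 2 + K₂ ^ 2) / 2
                * ((1 - ‖z‖ ^ 2) / (‖q.eval z‖ ^ 2 - ‖p.eval z‖ ^ 2))))
            * (1 / (1 - ‖z‖ ^ 2) ^ 2
                - ‖q.eval z * (derivative p).eval z - (derivative q).eval z * p.eval z‖ ^ 2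
                    / (‖q.eval z‖ ^ 2 - ‖p.eval z‖ ^ 2) ^ 2
                + (K₁ ^ 2 + K₂ ^ 2) / 2
                  * ((1 - ‖z‖ ^ 2)
                        * ‖(starRingEnd ℂ) ((derivative q).eval z) * q.eval z
                            - (starRingEnd ℂ) ((derivative p).eval z) * p.eval z‖ ^ 2
                        / (‖q.eval z‖ ^ 2 - ‖p.eval z‖ ^ 2) ^ 3
                    + 2 * (z * ((derivative q).eval z * (starRingEnd ℂ) (q.eval z)
                            - (derivative p).eval z * (starRingEnd ℂ) (p.eval z))).re
                        / (‖q.eval z‖ ^ 2 - ‖p.eval z‖ ^ 2) ^ 2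
                    + ‖z‖ ^ 2
                        / ((1 - ‖z‖ ^ 2) * (‖q.eval z‖ ^ 2 - ‖p.eval z‖ ^ 2)))) ∧
        (K₁ = 0 → K₂ = 0 →
          h z = 1 / Real.pi
            * (1 / (1 - ‖z‖ ^ 2) ^ 2
                - ‖q.eval z * (derivative p).eval z - (derivative q).eval z * p.eval z‖ ^ 2
                    / (‖q.eval z‖ ^ 2 - ‖p.eval z‖ ^ 2) ^ 2)) := by
  have h0 := hφ.coeff_zero_ne_zero
  have hex := isExpectedZeroDensity_gaussianZeroDensity ha hb hind
    (f := fun j : Fin (N + 1) => φ j) h0 (eq_C_of_natDegree_eq_zero (hφ.natDegree_eq 0))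
    (K₁ + K₂ * Complex.I)
  refine ⟨⟨_, hex⟩, fun h hh z hz => ?_⟩
  have hformula := hφ.gaussianZeroDensity_eq hp hq K₁ K₂ hz
  rw [← hh.unique hex] at hformula
  refine ⟨hformula, fun hK₁ hK₂ => ?_⟩
  rw [hformula, hK₁, hK₂]
  simp
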